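/- A Markov decision process (MDP) $M=(S,Act,P)$ consists of finite sets $S$ of states and $Act$ of actions, a nonempty set $En(s)\subseteq Act$ of enabled actions for every $s\in S$, and a probability distribution $P(s,a,\cdot)$ on $S$ for every $s\in S$ and $a\in En(s)$. An instance of the Autonomous MSSP (multi-agent stochastic shortest path) problem with $k\ge 1$ agents consists of an MDP $M$ and, for every agent $i\in\{1,\dots,k\}$, an initial state $\iota_i\in S$ and a set of target states $T_i\subseteq S$. A strategy $\sigma$ consists of a countable (finite or infinite) set $\mathit{Mem}$ of memory states, an initial memory state $m_0\in\mathit{Mem}$, and, for every $(s,m)\in S\times\mathit{Mem}$, a probability distribution $\sigma(s,m)$ on $En(s)\times\mathit{Mem}$. It induces a Markov chain $M_\sigma$ on $S\times\mathit{Mem}$: from $(s,m)$, draw $(a,m')$ from $\sigma(s,m)$, draw $t$ from $P(s,a,\cdot)$, and move to $(t,m')$. An (autonomous) profile is a tuple $\pi=(\sigma_1,\dots,\sigma_k)$ of strategies, with memories $\mathit{Mem}_1,\dots,\mathit{Mem}_k$. Under $\pi$ the agents move synchronously and independently, that is, agent $i$ performs a run of the Markov chain $M_{\sigma_i}$ from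 $\iota_i$ and the initial memory state of $\sigma_i$, and the runs of different agents are independent. Let $\mathit{MHit}\in\{0,1,2,\dots,\infty\}$ be the first time at which some agent $i$ is in a state of $T_i$ ($\infty$ if there is no such time), and let $\mathbb{E}_\pi[\mathit{MHit}]\in[0,\infty]$ be its expected value. Let $\Pi$ be the class of all profiles, and let $\Pi_n$ be the class of all profiles in which every $\mathit{Mem}_i$ has at most $n$ elements. A profile $\pi$ is finite-memory if every $\mathit{Mem}_i$ is finite, and it is $\varepsilon$-optimal if $\mathbb{E}_\pi[\mathit{MHit}]\le\inf_{\pi'\in\Pi}\mathbb{E}_{\pi'}[\mathit{MHit}]+\varepsilon$. Theorem. For every $n\ge 1$ there exist an instance of the Autonomous MSSP problem with two agents, with $\iota_i\notin T_i\neq\emptyset$ for $i\in\{1,2\}$, and a profile $\pi\in\Pi_{n+1}$ such that $$\mathbb{E}_\pi[\mathit{MHit}]<\inf_{\pi'\in\Pi_n}\mathbb{E}_{\pi'}[\mathit{MHit}].$$ Furthermore, for every instance of the Autonomous MSSP problem with $k\ge 1$ agents and every real $\varepsilon>0$ there exists an $\varepsilon$-optimal finite-memory profile. -/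

import Mathlib

open MeasureTheory ProbabilityTheory
open scoped ENNReal

noncomputable section

/-- A Markov decision process over the states `S` and the actions `Act` (both are required to be
finite wherever an MDP is used): every state `s` has a nonempty set `En s` of enabled actions, and
`P s a` is the distribution of the successor of `s` under the enabled action `a`. -/
structure MDP (S Act : Type*) where
  En : S → Set Act
  en_nonempty : ∀ s, (En s).Nonempty
  P : (s : S) → En s → PMF S

/-- An MSSP instance with `k` agents: an MDP and, for each agent, an initial state and a set of
target states. -/
structure MSSP (S Act : Type*) (k : ℕ) where
  M : MDP S Act
  init : Fin k → S
  target : Fin k → Set S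

namespace MDP

variable {S Act : Type*}

/-- A strategy of one agent: a countable (finite or infinite) set of memory states with an initial
memory state, and, for every state and memory state, a distribution over pairs consisting of an
enabled action and the next memory state. History-dependent randomized strategies are the case
where the memory states are the finite histories. -/
structure Strategy (M : MDP S Act) where
  Mem : Type
  mem_countable : Countable Mem
  m₀ : Mem
  act : (s : S) → Mem → PMF (M.En s × Mem)

namespace Strategy

variable {M : MDP S Act} (σ : M.Strategy)

/-- The states of the Markov chain `M_σ`: a state of the MDP with a memory state. -/
structure Conf where
  state : S
  mem : σ.Mem

/-- The discrete σ-algebra. -/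
instance : MeasurableSpace σ.Conf := ⊤

/-- One step of `M_σ`: from `(s, m)` draw `(a, m')` from `σ`, then draw `t` from `P s a`, and
move to `(t, m')`. -/
def step (c : σ.Conf) : PMF σ.Conf :=
  (σ.act c.state c.mem).bind fun x => (M.P c.state x.1).map fun t => ⟨t, x.2⟩

/-- The transition kernel of `M_σ`. -/
def kernel : Kernel σ.Conf σ.Conf := ⟨fun c => (σ.step c).toMeasure, measurable_from_top⟩

instance : IsMarkovKernel σ.kernel := ⟨fun c => PMF.toMeasure.isProbabilityMeasure (σ.step c)⟩

/-- The kernel of `M_σ` as a kernel from the first `n + 1` states of a run to the next one; it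
depends on the last state only. -/
def histKernel (n : ℕ) : Kernel (Finset.Iic n → σ.Conf) σ.Conf :=
  σ.kernel.comap (fun h => h ⟨n, Finset.mem_Iic.2 le_rfl⟩) (measurable_pi_apply _)

instance (n : ℕ) : IsMarkovKernel (σ.histKernel n) := by
  unfold histKernel; infer_instance

/-- The probability measure on the runs of `M_σ` started in `(s, m₀)`. -/
def runMeasure (s : S) : Measure (ℕ → σ.Conf) :=
  Kernel.traj (X := fun _ => σ.Conf) σ.histKernel 0 fun _ => ⟨s, σ.m₀⟩

end Strategy

end MDP

namespace MSSP

variable {S Act : Type*} {k : ℕ} (I : MSSP S Act k)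

/-- An autonomous strategy profile: one strategy for each agent, which sees only the state and
the memory of this agent. -/
abbrev Profile : Type _ := Fin k → I.M.Strategy

namespace Profile

variable {I} (π : I.Profile)

/-- The measure on `k`-tuples of runs: the agents move independently of each other. -/
def measure : Measure (∀ i, ℕ → (π i).Conf) := Measure.pi fun i => (π i).runMeasure (I.init i)

/-- The first time at which some agent is in one of its target states (`∞` if there is none). -/
def MHit (ω : ∀ i, ℕ → (π i).Conf) : ℝ≥0∞ :=
  ⨅ (t : ℕ) (_ : ∃ i, (ω i t).state ∈ I.target i), (t : ℝ≥0∞)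

/-- The expected value of `MHit`, in `[0, ∞]`. -/
def EMHit : ℝ≥0∞ := ∫⁻ ω, π.MHit ω ∂π.measure

/-- The class `Π_n`: every agent has at most `n` memory states. -/
def MemAtMost (n : ℕ) : Prop := ∀ i, ENat.card (π i).Mem ≤ n

/-- Every agent has finitely many memory states. -/
def FiniteMemory : Prop := ∀ i, Finite (π i).Mem

/-- `π` is `ε`-optimal among all autonomous profiles. -/
def IsEpsOptimal (ε : ℝ) : Prop := π.EMHit ≤ (⨅ π' : I.Profile, π'.EMHit) + ENNReal.ofReal ε

end Profile

end MSSP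

end

/-!
The survival probability of an agent at time `t` is the probability that it visits none of its
targets at the times `0, …, t`. The agents are independent, so the expected hitting time of a
profile is the sum over `t` of the products of the survival probabilities of the agents
(`MSSP.Profile.EMHit_eq_tsum`). Both halves of the theorem are therefore statements about the
survival probabilities of single agents, which satisfy a recursion on `t` (`MDP.Strategy.surv`).

*Near-optimal finite memory.* If the infimum of the costs is infinite, any finite-memory profile
will do. Otherwise take a profile of nearly minimal, finite cost. The product of its survival
probabilities tends to `0`, so the survival probability of some agent does
(`MSSP.Profile.exists_vanishes_of_EMHit_ne_top`): this agent visits its targets almost surely, and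
until then it never leaves the set of states from which some strategy does so. On this set one
memoryless strategy, which draws uniformly among the actions that cannot leave the set, has a
survival probability that decays geometrically at a uniform rate
(`MDP.Strategy.exists_memoryless_decay`). Now let every agent follow its strategy for `N` rounds
only, give up as soon as its memory leaves a finite set, and play the memoryless strategy from
then on (`MDP.Strategy.truncate`). The cost after time `N` is then at most a constant times the
product of the survival probabilities at time `N`, where the constant does not depend on `N`
(`MSSP.Profile.EMHit_le_of_decay`), and for large finite sets the cost before time `N` is close to
that of the original profile (`MDP.Strategy.tendsto_survOrLeave`). It remains to take `N` large,
and then the finite sets.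

*Memory `n + 1` beats memory `n`.* In `gapMSSP n` the first agent has no influence and hits its
target at time `n + 2`, so only the survival of the second agent before that time counts. In each
round the second agent may play safe, hitting with probability `1 / 2` and staying in `wait`
otherwise, or gamble, hitting with probability `3 / 5` and being lost otherwise. The cost is a
constant plus a weighted sum of the probabilities `b t` of gambling in round `t`, in which the
weight of round `n` is `- 1 / 10` and those of the earlier rounds are at least `1 / 20`
(`MSSP.Profile.toReal_EMHit_gapMSSP_eq`). Counting to `n` in the memory gives `b n` its maximal
value `2⁻¹ ^ n` and makes all the earlier `b t` vanish. With only `n` memory states, a sequence of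
memory states along which the agent plays safe for `n` rounds contains a cycle; removing it gives
a sequence of at least the same probability along which the agent gambles too early. Hence `b n ≤
n ^ n * ∑ t < n, b t` (`MDP.Strategy.gambleProb_le_sum`), which keeps the cost away from the
optimum.
-/

open Filter Topology

noncomputable section

/-! ### Averages over a probability mass function -/

namespace PMF

variable {α β : Type*}

lemma tsum_map_mul (p : PMF α) (f : α → β) (g : β → ℝ≥0∞) :
    ∑' b, p.map f b * g b = ∑' a, p a * g (f a) := by
  classical
  simp_rw [PMF.map_apply, ← ENNReal.tsum_mul_right]
  rw [ENNReal.tsum_comm]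
  refine tsum_congr fun a => ?_
  rw [tsum_eq_single (f a)]
  · simp
  · intro b hb; simp [hb]

lemma tsum_mul_le (p : PMF α) {f : α → ℝ≥0∞} {c : ℝ≥0∞}
    (hf : ∀ a ∈ p.support, f a ≤ c) : ∑' a, p a * f a ≤ c := by
  calc ∑' a, p a * f a ≤ ∑' a, p a * c := by
        refine ENNReal.tsum_le_tsum fun a => ?_
        by_cases ha : a ∈ p.support
        · gcongr; exact hf a ha
        · simp [(p.apply_eq_zero_iff a).2 ha]
    _ = c := by rw [ENNReal.tsum_mul_right, p.tsum_coe, one_mul]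

lemma tsum_mul_mono (p : PMF α) {f g : α → ℝ≥0∞} (h : ∀ a ∈ p.support, f a ≤ g a) :
    ∑' a, p a * f a ≤ ∑' a, p a * g a := by
  refine ENNReal.tsum_le_tsum fun a => ?_
  by_cases ha : a ∈ p.support
  · gcongr; exact h a ha
  · simp [(p.apply_eq_zero_iff a).2 ha]

lemma tsum_mul_lt_one (p : PMF α) {f : α → ℝ≥0∞} (hf : ∀ a, f a ≤ 1) {a : α}
    (ha : a ∈ p.support) (hfa : f a < 1) : ∑' a, p a * f a < 1 := by
  rw [← p.tsum_coe]
  refine ENNReal.tsum_lt_tsum (i := a) ?_ (fun a => mul_le_of_le_one_right' (hf a)) ?_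
  · exact ne_top_of_le_ne_top ENNReal.one_ne_top (p.tsum_mul_le fun a _ => hf a)
  · calc p a * f a < p a * 1 := by
          exact (ENNReal.mul_lt_mul_iff_right ((p.mem_support_iff a).1 ha) (p.apply_ne_top a)).2 hfa
      _ = p a := mul_one _

/-- Dominated convergence for averages of functions that are bounded by `1`. -/
lemma tendsto_tsum_mul (p : PMF α) {F : ℕ → α → ℝ≥0∞} {f : α → ℝ≥0∞} (hF : ∀ n a, F n a ≤ 1)
    (h : ∀ a, Tendsto (fun n => F n a) atTop (𝓝 (f a))) :
    Tendsto (fun n => ∑' a, p a * F n a) atTop (𝓝 (∑' a, p a * f a)) := by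
  let _ : MeasurableSpace α := ⊤
  have key := tendsto_lintegral_of_dominated_convergence (μ := Measure.count)
    (F := fun n a => p a * F n a) (f := fun a => p a * f a) p
    (fun n => measurable_from_top) (fun n => Eventually.of_forall fun a =>
      mul_le_of_le_one_right' (hF n a)) ?_ (Eventually.of_forall fun a =>
      ENNReal.Tendsto.const_mul (h a) (Or.inr (p.apply_ne_top a)))
  · simpa only [lintegral_count' measurable_from_top] using key
  · rw [lintegral_count' measurable_from_top, p.tsum_coe]
    exact ENNReal.one_ne_top

end PMF

/-! ### Survival probabilities -/

namespace MDP.Strategy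

variable {S Act : Type*} {M : MDP S Act}

open scoped Classical in
/-- The probability that `σ`, started in state `s` with memory `m`, visits no state of `T` at the
times `0, …, t`, defined by conditioning on the first step. -/
def surv (σ : M.Strategy) (T : Set S) : ℕ → S → σ.Mem → ℝ≥0∞
  | 0, s, _ => if s ∈ T then 0 else 1
  | t + 1, s, m => if s ∈ T then 0 else
      ∑' x, σ.act s m x * ∑' s', M.P s x.1 s' * surv σ T t s' x.2

variable (σ : M.Strategy) (T : Set S)

lemma surv_of_mem {s : S} (hs : s ∈ T) (t : ℕ) (m : σ.Mem) : σ.surv T t s m = 0 := by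
  cases t <;> simp [surv, hs]

lemma surv_zero_of_notMem {s : S} (hs : s ∉ T) (m : σ.Mem) : σ.surv T 0 s m = 1 := by
  simp [surv, hs]

lemma surv_succ_of_notMem {s : S} (hs : s ∉ T) (t : ℕ) (m : σ.Mem) :
    σ.surv T (t + 1) s m = ∑' x, σ.act s m x * ∑' s', M.P s x.1 s' * σ.surv T t s' x.2 := by
  simp [surv, hs]

lemma surv_le_one (t : ℕ) (s : S) (m : σ.Mem) : σ.surv T t s m ≤ 1 := by
  induction t generalizing s m with
  | zero => by_cases hs : s ∈ T <;> simp [surv, hs]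
  | succ t ih =>
    by_cases hs : s ∈ T
    · simp [surv, hs]
    · rw [surv_succ_of_notMem _ _ hs]
      exact PMF.tsum_mul_le _ fun x _ => PMF.tsum_mul_le _ fun s' _ => ih _ _

lemma surv_antitone (s : S) (m : σ.Mem) : Antitone fun t => σ.surv T t s m := by
  refine antitone_nat_of_succ_le fun t => ?_
  induction t generalizing s m with
  | zero =>
    by_cases hs : s ∈ T
    · simp [surv_of_mem _ _ hs]
    · rw [surv_zero_of_notMem _ _ hs]; exact σ.surv_le_one T _ s m
  | succ t ih =>
    by_cases hs : s ∈ T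
    · simp [surv_of_mem _ _ hs]
    · rw [surv_succ_of_notMem _ _ hs, surv_succ_of_notMem _ _ hs]
      gcongr
      exact ih _ _

/-! ### Runs of the Markov chain of a strategy -/

instance [Countable S] : Countable σ.Conf := by
  have := σ.mem_countable
  exact Function.Injective.countable (f := fun c : σ.Conf => (c.state, c.mem))
    fun ⟨_, _⟩ ⟨_, _⟩ h => by simp_all

instance : DiscreteMeasurableSpace σ.Conf := ⟨fun _ => trivial⟩

instance (s : S) : IsProbabilityMeasure (σ.runMeasure s) := by
  unfold runMeasure; infer_instance

/-- Integration against one step of the chain, as a sum over actions and successors. -/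
lemma lintegral_step [Countable S] (c : σ.Conf) (g : σ.Conf → ℝ≥0∞) :
    ∫⁻ d, g d ∂(σ.step c).toMeasure =
      ∑' x, σ.act c.state c.mem x * ∑' s', M.P c.state x.1 s' * g ⟨s', x.2⟩ := by
  classical
  rw [lintegral_countable']
  have h1 : ∀ d, (σ.step c).toMeasure {d} = σ.step c d := fun d =>
    PMF.toMeasure_apply_singleton _ _ (measurableSet_singleton d)
  have h2 : ∀ x : M.En c.state × σ.Mem, ∑' d : σ.Conf,
      g d * ((M.P c.state x.1).map fun t => (⟨t, x.2⟩ : σ.Conf)) d =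
        ∑' s', M.P c.state x.1 s' * g ⟨s', x.2⟩ := by
    intro x
    simp_rw [PMF.map_apply, ← ENNReal.tsum_mul_left]
    rw [ENNReal.tsum_comm]
    refine tsum_congr fun s' => ?_
    rw [tsum_eq_single ⟨s', x.2⟩]
    · simp [mul_comm]
    · intro d hd; simp [hd]
  simp_rw [h1, step, PMF.bind_apply, ← h2, ← ENNReal.tsum_mul_left]
  rw [ENNReal.tsum_comm]
  exact tsum_congr fun _ => tsum_congr fun _ => by ring

/-- The Markov property: given the first `t + 1` states of a run, the next one is distributed
according to a step from the last of them. -/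
lemma lintegral_runMeasure_succ (s : S) (t : ℕ)
    {F : (Finset.Iic t → σ.Conf) → ℝ≥0∞} (hF : Measurable F) (g : σ.Conf → ℝ≥0∞) :
    ∫⁻ ω, F (Preorder.frestrictLe t ω) * g (ω (t + 1)) ∂σ.runMeasure s =
      ∫⁻ ω, F (Preorder.frestrictLe t ω) * ∫⁻ d, g d ∂(σ.step (ω t)).toMeasure
        ∂σ.runMeasure s := by
  have hg : Measurable g := measurable_from_top
  have hmap := Kernel.partialTraj_compProd_eq_map_traj (κ := σ.histKernel) (X := fun _ => σ.Conf)
    (Nat.zero_le t) (x₀ := fun _ => (⟨s, σ.m₀⟩ : σ.Conf))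
  have h1 : ∫⁻ ω, F (Preorder.frestrictLe t ω) * g (ω (t + 1)) ∂σ.runMeasure s =
      ∫⁻ y, F y.1 * g y.2 ∂((σ.runMeasure s).map
        fun ω => (Preorder.frestrictLe t ω, ω (t + 1))) := by
    rw [lintegral_map (by fun_prop) (by fun_prop)]
  have hk : Measurable fun d : σ.Conf => ∫⁻ d', g d' ∂(σ.step d).toMeasure := measurable_from_top
  rw [h1, runMeasure, ← hmap, Measure.lintegral_compProd (by fun_prop),
    ← Kernel.traj_map_frestrictLe_apply,
    lintegral_map (Measurable.lintegral_kernel_prod_right (by fun_prop)) (by fun_prop)]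
  refine lintegral_congr fun ω => ?_
  change ∫⁻ b, F (Preorder.frestrictLe t ω) * g b ∂(σ.step (ω t)).toMeasure = _
  exact lintegral_const_mul _ hg

/-- The event of no visit to `T` up to time `t` has the probability given by `surv`. -/
lemma runMeasure_forall_notMem [Countable S] (s : S) (t : ℕ) :
    σ.runMeasure s {ω | ∀ u ≤ t, (ω u).state ∉ T} = σ.surv T t s σ.m₀ := by
  classical
  -- `L` is the operator whose iterates define `surv`
  let L : (σ.Conf → ℝ≥0∞) → σ.Conf → ℝ≥0∞ := fun g c =>
    if c.state ∈ T then 0 else ∫⁻ d, g d ∂(σ.step c).toMeasure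
  let A : (t : ℕ) → (Finset.Iic t → σ.Conf) → ℝ≥0∞ := fun t h =>
    if ∀ u, (h u).state ∉ T then 1 else 0
  have hset : ∀ t : ℕ, MeasurableSet {h : Finset.Iic t → σ.Conf | ∀ u, (h u).state ∉ T} := by
    intro t
    exact MeasurableSet.of_discrete
  have hA : ∀ t, Measurable (A t) := fun t =>
    Measurable.ite (hset t) measurable_const measurable_const
  have hsucc : ∀ (t : ℕ) (ω : ℕ → σ.Conf) (g : σ.Conf → ℝ≥0∞),
      A (t + 1) (Preorder.frestrictLe (t + 1) ω) * ∫⁻ d, g d ∂(σ.step (ω (t + 1))).toMeasure =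
        A t (Preorder.frestrictLe t ω) * L g (ω (t + 1)) := by
    intro t ω g
    have h1 : (∀ u, ((Preorder.frestrictLe (π := fun _ => σ.Conf) (t + 1) ω) u).state ∉ T) ↔
        (∀ u, ((Preorder.frestrictLe (π := fun _ => σ.Conf) t ω) u).state ∉ T) ∧
          (ω (t + 1)).state ∉ T := by
      simp only [Preorder.frestrictLe_apply, Subtype.forall, Finset.mem_Iic]
      exact ⟨fun H => ⟨fun u hu => H u (by omega), H _ le_rfl⟩, fun H u hu =>
        (Nat.le_succ_iff.1 hu).elim (H.1 u) fun h => h ▸ H.2⟩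
    simp only [A, L, h1]
    by_cases h2 : (ω (t + 1)).state ∈ T <;> simp [h2]
  have hmain : ∀ (t : ℕ) (g : σ.Conf → ℝ≥0∞),
      ∫⁻ ω, A t (Preorder.frestrictLe t ω) * (∫⁻ d, g d ∂(σ.step (ω t)).toMeasure)
        ∂σ.runMeasure s = L^[t + 1] g ⟨s, σ.m₀⟩ := by
    intro t
    induction t with
    | zero =>
      intro g
      have hmap := Kernel.traj_map_frestrictLe_apply (X := fun _ => σ.Conf) (κ := σ.histKernel) 0 0
        (fun _ => (⟨s, σ.m₀⟩ : σ.Conf))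
      rw [Kernel.partialTraj_self, Kernel.id_apply] at hmap
      have hm : Measurable fun h : Finset.Iic 0 → σ.Conf =>
          A 0 h * (∫⁻ d, g d ∂(σ.step (h ⟨0, by simp⟩)).toMeasure) := by
        refine (hA 0).mul ?_
        have hk : Measurable fun d : σ.Conf => ∫⁻ d', g d' ∂(σ.step d).toMeasure :=
          measurable_from_top
        exact hk.comp (measurable_pi_apply _)
      have := lintegral_map (μ := σ.runMeasure s) hm
        (Preorder.measurable_frestrictLe (X := fun _ => σ.Conf) 0)
      rw [runMeasure, hmap, lintegral_dirac' _ hm] at this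
      rw [runMeasure]
      refine this.symm.trans ?_
      by_cases hs : s ∈ T <;> simp [A, L, hs]
    | succ t ih =>
      intro g
      simp_rw [hsucc]
      rw [σ.lintegral_runMeasure_succ s t (hA t), ih]
      rfl
  have hsurv : ∀ t, (fun c : σ.Conf => σ.surv T t c.state c.mem) = L^[t + 1] (fun _ => 1) := by
    intro t
    induction t with
    | zero =>
      ext c
      by_cases hs : c.state ∈ T <;> simp [L, surv, hs]
    | succ t ih =>
      rw [Function.iterate_succ_apply', ← ih]
      ext c
      by_cases hs : c.state ∈ T
      · simp [L, surv, hs]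
      · simp [L, surv_succ_of_notMem _ _ hs, hs, lintegral_step]
  have h := hmain t (fun _ => 1)
  rw [← hsurv] at h
  simp only [lintegral_const, measure_univ, mul_one] at h
  rw [← h]
  have hpre : {ω : ℕ → σ.Conf | ∀ u ≤ t, (ω u).state ∉ T} =
      Preorder.frestrictLe (π := fun _ => σ.Conf) t ⁻¹' {h | ∀ u, (h u).state ∉ T} := by
    ext ω; simp [Subtype.forall, Preorder.frestrictLe_apply]
  have hms : MeasurableSet {ω : ℕ → σ.Conf | ∀ u ≤ t, (ω u).state ∉ T} := by
    rw [hpre]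
    exact Preorder.measurable_frestrictLe (X := fun _ => σ.Conf) t (hset t)
  rw [← lintegral_indicator_one hms]
  refine lintegral_congr fun ω => ?_
  simp only [A, Set.indicator, Subtype.forall, Preorder.frestrictLe_apply, Finset.mem_Iic,
    Set.mem_ofPred_eq, Pi.one_apply]
  congr

end MDP.Strategy

namespace MSSP.Profile

variable {S Act : Type*} {k : ℕ} {I : MSSP S Act k} (π : I.Profile)

/-- The probability that agent `i` survives up to time `t`, that is, visits none of its targets at
the times `0, …, t`. -/
def agentSurv (i : Fin k) (t : ℕ) : ℝ≥0∞ := (π i).surv (I.target i) t (I.init i) (π i).m₀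

lemma agentSurv_le_one (i : Fin k) (t : ℕ) : π.agentSurv i t ≤ 1 := MDP.Strategy.surv_le_one ..

lemma agentSurv_antitone (i : Fin k) : Antitone (π.agentSurv i) := MDP.Strategy.surv_antitone ..

open scoped Classical in
lemma MHit_eq_tsum (ω : ∀ i, ℕ → (π i).Conf) :
    π.MHit ω = ∑' t, if ∀ i, ∀ u ≤ t, (ω i u).state ∉ I.target i then (1 : ℝ≥0∞) else 0 := by
  by_cases h : ∃ t, ∃ i, (ω i t).state ∈ I.target i
  · have hlt : ∀ t, (∀ i, ∀ u ≤ t, (ω i u).state ∉ I.target i) ↔ t < Nat.find h := by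
      intro t
      rw [Nat.lt_find_iff]
      push Not
      exact ⟨fun H u hu i => H i u hu, fun H i u hu => H u hu i⟩
    simp_rw [hlt]
    rw [tsum_eq_sum (s := Finset.range (Nat.find h)) (by simp)]
    rw [Finset.sum_congr rfl (g := fun _ => 1) (by simp +contextual)]
    rw [MHit]
    simp only [Finset.sum_const, Finset.card_range, nsmul_eq_mul, mul_one]
    refine le_antisymm (iInf₂_le (Nat.find h) (Nat.find_spec h)) (le_iInf₂ fun t ht => ?_)
    exact_mod_cast Nat.find_min' h ht
  · push Not at h
    simp [MHit, h]

/-- By independence, the expected hitting time is the sum over time of the products of the survival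
probabilities of the agents. -/
lemma EMHit_eq_tsum [Countable S] : π.EMHit = ∑' t, ∏ i, π.agentSurv i t := by
  classical
  have hset : ∀ t i, MeasurableSet {ω : ℕ → (π i).Conf | ∀ u ≤ t, (ω u).state ∉ I.target i} := by
    intro t i
    simp only [Set.ofPred_forall]
    refine MeasurableSet.iInter fun u => MeasurableSet.iInter fun _ => ?_
    have hu : Measurable fun ω : ℕ → (π i).Conf => ω u := measurable_pi_apply u
    exact hu (MeasurableSet.of_discrete (s := {c : (π i).Conf | c.state ∉ I.target i}))
  have hpi : ∀ t, {ω : ∀ i, ℕ → (π i).Conf | ∀ i, ∀ u ≤ t, (ω i u).state ∉ I.target i} =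
      Set.univ.pi fun i => {ω | ∀ u ≤ t, (ω u).state ∉ I.target i} := by
    intro t; ext ω; simp
  have hset' : ∀ t, MeasurableSet
      {ω : ∀ i, ℕ → (π i).Conf | ∀ i, ∀ u ≤ t, (ω i u).state ∉ I.target i} := by
    intro t
    rw [hpi]
    exact MeasurableSet.univ_pi (hset t)
  simp_rw [EMHit, MHit_eq_tsum]
  rw [lintegral_tsum fun t =>
    (Measurable.ite (hset' t) measurable_const measurable_const).aemeasurable]
  refine tsum_congr fun t => ?_
  have : π.measure {ω | ∀ i, ∀ u ≤ t, (ω i u).state ∉ I.target i} = ∏ i, π.agentSurv i t := by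
    rw [hpi, measure, Measure.pi_pi]
    exact Finset.prod_congr rfl fun i _ => MDP.Strategy.runMeasure_forall_notMem ..
  rw [← this, ← lintegral_indicator_one (hset' t)]
  refine lintegral_congr fun ω => ?_
  simp [Set.indicator]

end MSSP.Profile

namespace MDP.Strategy

variable {S Act : Type*} {M : MDP S Act} (σ : M.Strategy) (T : Set S)

/-! ### A memoryless strategy with geometric decay of the survival probability -/

/-- The target set `T` is visited almost surely by `σ` started in state `s` with memory `m`,
expressed by the convergence of the survival probability to `0`. -/
def Vanishes (s : S) (m : σ.Mem) : Prop := Tendsto (fun t => σ.surv T t s m) atTop (𝓝 0)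

variable {σ T} in
lemma Vanishes.succ {s : S} {m : σ.Mem} (h : σ.Vanishes T s m) (hs : s ∉ T)
    {x : M.En s × σ.Mem} (hx : x ∈ (σ.act s m).support) {s' : S} (hs' : s' ∈ (M.P s x.1).support) :
    σ.Vanishes T s' x.2 := by
  set c : ℝ≥0∞ := σ.act s m x * M.P s x.1 s' with hc
  have hc0 : c ≠ 0 := mul_ne_zero ((PMF.mem_support_iff _ _).1 hx) ((PMF.mem_support_iff _ _).1 hs')
  have hct : c ≠ ∞ := ENNReal.mul_ne_top (PMF.apply_ne_top _ _) (PMF.apply_ne_top _ _)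
  have hle : ∀ t, σ.surv T t s' x.2 ≤ c⁻¹ * σ.surv T (t + 1) s m := by
    intro t
    have : c * σ.surv T t s' x.2 ≤ σ.surv T (t + 1) s m := by
      rw [surv_succ_of_notMem _ _ hs, hc, mul_assoc]
      refine le_trans ?_ (ENNReal.le_tsum x)
      gcongr
      exact ENNReal.le_tsum (f := fun s' => M.P s x.1 s' * σ.surv T t s' x.2) s'
    calc σ.surv T t s' x.2 = c⁻¹ * (c * σ.surv T t s' x.2) := by
          rw [← mul_assoc, ENNReal.inv_mul_cancel hc0 hct, one_mul]
      _ ≤ _ := by gcongr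
  have hlim : Tendsto (fun t => c⁻¹ * σ.surv T (t + 1) s m) atTop (𝓝 0) := by
    have := ENNReal.Tendsto.const_mul (a := c⁻¹) ((tendsto_add_atTop_iff_nat 1).2 h)
      (Or.inr (ENNReal.inv_ne_top.2 hc0))
    simpa using this
  exact tendsto_of_tendsto_of_tendsto_of_le_of_le tendsto_const_nhds hlim (fun _ => zero_le) hle

/-- The strategy without memory that draws its action in state `s` from `ρ s`. -/
abbrev memoryless (ρ : ∀ s, PMF (M.En s)) : M.Strategy where
  Mem := Unit
  mem_countable := inferInstance
  m₀ := ()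
  act s _ := (ρ s).map fun a => (a, ())

lemma surv_memoryless_succ (ρ : ∀ s, PMF (M.En s)) {s : S} (hs : s ∉ T) (t : ℕ) :
    (memoryless ρ).surv T (t + 1) s () =
      ∑' a, ρ s a * ∑' s', M.P s a s' * (memoryless ρ).surv T t s' () := by
  rw [surv_succ_of_notMem _ _ hs]
  exact PMF.tsum_map_mul _ _ _

/-- The states from which some strategy visits `T` almost surely. -/
def winning (M : MDP S Act) (T : Set S) : Set S :=
  {s | ∃ (σ : M.Strategy) (m : σ.Mem), σ.Vanishes T s m}

/-- The actions whose successors all lie in `winning M T`. -/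
def safe (M : MDP S Act) (T : Set S) (s : S) : Set (M.En s) :=
  {a | ∀ s' ∈ (M.P s a).support, s' ∈ winning M T}

variable {σ T} in
lemma Vanishes.mem_safe {s : S} {m : σ.Mem} (h : σ.Vanishes T s m) (hs : s ∉ T)
    {x : M.En s × σ.Mem} (hx : x ∈ (σ.act s m).support) : x.1 ∈ safe M T s :=
  fun _ hs' => ⟨σ, x.2, h.succ hs hx hs'⟩

lemma safe_nonempty {s : S} (hs : s ∉ T) (hw : s ∈ winning M T) : (safe M T s).Nonempty := by
  obtain ⟨σ, m, h⟩ := hw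
  obtain ⟨x, hx⟩ := (σ.act s m).support_nonempty
  exact ⟨x.1, h.mem_safe hs hx⟩

/-- A path to `T` with which `σ` visits `T` by time `t` uses safe actions only, so a memoryless
strategy that plays all safe actions follows it with positive probability. -/
lemma surv_memoryless_lt_one {ρ : ∀ s, PMF (M.En s)}
    (hρ : ∀ s, (safe M T s).Nonempty → (ρ s).support = safe M T s) (t : ℕ) {s : S} {m : σ.Mem}
    (h : σ.Vanishes T s m) (hlt : σ.surv T t s m < 1) : (memoryless ρ).surv T t s () < 1 := by
  induction t generalizing s m with
  | zero =>
    by_cases hs : s ∈ T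
    · simp [surv_of_mem _ _ hs]
    · simp [surv_zero_of_notMem _ _ hs] at hlt
  | succ t ih =>
    by_cases hs : s ∈ T
    · simp [surv_of_mem _ _ hs]
    obtain ⟨x, hx, s', hs', hlt'⟩ : ∃ x ∈ (σ.act s m).support, ∃ s' ∈ (M.P s x.1).support,
        σ.surv T t s' x.2 < 1 := by
      by_contra! hcon
      refine hlt.not_ge ?_
      rw [surv_succ_of_notMem _ _ hs]
      calc (1 : ℝ≥0∞) = ∑' x, σ.act s m x * ∑' s', M.P s x.1 s' * 1 := by simp [PMF.tsum_coe]
        _ ≤ _ := PMF.tsum_mul_mono _ fun x hx => PMF.tsum_mul_mono _ fun s' hs' => hcon x hx s' hs'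
    rw [surv_memoryless_succ _ _ hs]
    have hsafe := h.mem_safe hs hx
    refine PMF.tsum_mul_lt_one _ (fun a => PMF.tsum_mul_le _ fun _ _ => surv_le_one ..)
      (a := x.1) ((hρ s ⟨_, hsafe⟩).symm ▸ hsafe) ?_
    exact PMF.tsum_mul_lt_one _ (fun _ => surv_le_one ..) hs' (ih (h.succ hs hx hs') hlt')

/-- There is a memoryless strategy whose survival probability decays geometrically, at a uniform
rate, from all states from which `T` can be visited almost surely. -/
lemma exists_memoryless_decay [Finite S] [Finite Act] (M : MDP S Act) (T : Set S) :
    ∃ (ρ : ∀ s, PMF (M.En s)) (n : ℕ) (q : ℝ≥0∞), 0 < n ∧ q < 1 ∧ ∀ s ∈ winning M T, ∀ t,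
      (memoryless ρ).surv T (t + n) s () ≤ q * (memoryless ρ).surv T t s () := by
  classical
  have := Fintype.ofFinite S
  have := Fintype.ofFinite Act
  have hex : ∀ s, ∃ p : PMF (M.En s), (safe M T s).Nonempty → p.support = safe M T s := by
    intro s
    by_cases h : (safe M T s).Nonempty
    · refine ⟨PMF.uniformOfFinset (safe M T s).toFinset (by simpa using h), fun _ => ?_⟩
      ext a; simp
    · exact ⟨PMF.pure ⟨_, (M.en_nonempty s).choose_spec⟩, fun h' => absurd h' h⟩
  choose ρ hρ using hex
  have hlt : ∀ s, ∃ t, s ∈ winning M T → (memoryless ρ).surv T t s () < 1 := by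
    intro s
    by_cases h : s ∈ winning M T
    · obtain ⟨σ, m, hv⟩ := h
      obtain ⟨t, ht⟩ := (hv.eventually_lt_const one_pos).exists
      exact ⟨t, fun _ => surv_memoryless_lt_one σ T hρ t hv ht⟩
    · exact ⟨0, fun h' => absurd h' h⟩
  choose t₀ ht₀ using hlt
  -- from every winning state, `T` is visited within `n` steps with probability at least `1 - q`
  set n := Finset.univ.sup t₀ + 1
  set q : ℝ≥0∞ :=
    Finset.univ.sup fun s => if s ∈ winning M T then (memoryless ρ).surv T n s () else 0
  refine ⟨ρ, n, q, Nat.succ_pos _, ?_, ?_⟩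
  · refine (Finset.sup_lt_iff one_pos).2 fun s _ => ?_
    split_ifs with hs
    · refine lt_of_le_of_lt (surv_antitone (memoryless ρ) T s () ?_) (ht₀ s hs)
      exact (Finset.le_sup (Finset.mem_univ s)).trans (Nat.le_succ _)
    · exact one_pos
  · intro s hw t
    induction t generalizing s with
    | zero =>
      by_cases hs : s ∈ T
      · simp [surv_of_mem _ _ hs]
      · rw [surv_zero_of_notMem _ _ hs, zero_add, mul_one]
        have := Finset.le_sup (f := fun s => if s ∈ winning M T then
          (memoryless ρ).surv T n s () else 0) (Finset.mem_univ s)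
        simpa only [hw, if_true] using this
    | succ t ih =>
      by_cases hs : s ∈ T
      · simp [surv_of_mem _ _ hs]
      · rw [show t + 1 + n = t + n + 1 by omega, surv_memoryless_succ _ _ hs,
          surv_memoryless_succ _ _ hs, ← ENNReal.tsum_mul_left]
        refine (PMF.tsum_mul_mono _ fun a ha => ?_).trans_eq
          (tsum_congr fun a => mul_left_comm (ρ s a) q _)
        rw [hρ s (safe_nonempty T hs hw)] at ha
        rw [← ENNReal.tsum_mul_left]
        exact (PMF.tsum_mul_mono _ fun s' hs' => ih s' (ha s' hs')).trans_eq
          (tsum_congr fun s' => mul_left_comm (M.P s a s') q _)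

/-! ### Truncation of a strategy to finite memory -/

/-- An injective numbering of the memory states. -/
def memIndex : σ.Mem → ℕ := (countable_iff_exists_injective _).1 σ.mem_countable |>.choose

lemma memIndex_injective : Function.Injective σ.memIndex :=
  ((countable_iff_exists_injective _).1 σ.mem_countable).choose_spec

/-- The memory state of the truncated strategy that represents `m` with `r` rounds to go: `none` if
no round is left or `m` is not among the first `L` memory states, and otherwise `m` with the number
`r - 1` of rounds that remain after the current one. -/
def cut (N L : ℕ) (m : σ.Mem) : ℕ → Option ({m : σ.Mem // σ.memIndex m < L} × Fin N)
  | 0 => none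
  | r + 1 => if h : σ.memIndex m < L ∧ r < N then some (⟨m, h.1⟩, ⟨r, h.2⟩) else none

/-- The strategy that plays like `σ` for `N` rounds, as long as the memory stays among the first
`L` memory states, and then draws its actions from `ρ`. -/
abbrev truncate (ρ : ∀ s, PMF (M.En s)) (N L : ℕ) : M.Strategy where
  Mem := Option ({m : σ.Mem // σ.memIndex m < L} × Fin N)
  mem_countable := by have := σ.mem_countable; infer_instance
  m₀ := σ.cut N L σ.m₀ N
  act s m := match m with
    | none => (ρ s).map fun a => (a, none)
    | some (m, r) => (σ.act s m).map fun x => (x.1, σ.cut N L x.2 r)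

variable (ρ : ∀ s, PMF (M.En s)) (N L : ℕ)

lemma finite_mem_truncate : Finite (σ.truncate ρ N L).Mem := by
  have : Finite {m : σ.Mem // σ.memIndex m < L} :=
    Finite.of_injective (fun m => (⟨σ.memIndex m, m.2⟩ : Fin L)) fun a b h =>
      Subtype.ext (σ.memIndex_injective (by simpa using h))
  exact inferInstanceAs (Finite (Option _))

lemma surv_truncate_none (t : ℕ) (s : S) :
    (σ.truncate ρ N L).surv T t s none = (memoryless ρ).surv T t s () := by
  induction t generalizing s with
  | zero => rfl
  | succ t ih =>
    by_cases hs : s ∈ T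
    · simp [surv_of_mem _ _ hs]
    · rw [surv_succ_of_notMem _ _ hs, surv_memoryless_succ _ _ hs]
      simp_rw [← ih]
      exact PMF.tsum_map_mul _ _ _

lemma surv_truncate_some {s : S} (hs : s ∉ T) (t : ℕ) (m : {m : σ.Mem // σ.memIndex m < L})
    (r : Fin N) :
    (σ.truncate ρ N L).surv T (t + 1) s (some (m, r)) =
      ∑' x, σ.act s m x * ∑' s', M.P s x.1 s' *
        (σ.truncate ρ N L).surv T t s' (σ.cut N L x.2 r) := by
  rw [surv_succ_of_notMem _ _ hs]
  exact PMF.tsum_map_mul _ _ _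

open scoped Classical in
/-- The probability that `σ` has not visited `T` by time `t`, or its memory has left the first `L`
memory states before that. -/
def survOrLeave : ℕ → S → σ.Mem → ℝ≥0∞
  | 0, s, _ => if s ∈ T then 0 else 1
  | t + 1, s, m => if s ∈ T then 0 else
      ∑' x, σ.act s m x *
        if σ.memIndex x.2 < L then ∑' s', M.P s x.1 s' * survOrLeave t s' x.2 else 1

lemma survOrLeave_le_one (t : ℕ) (s : S) (m : σ.Mem) : σ.survOrLeave T L t s m ≤ 1 := by
  induction t generalizing s m with
  | zero => by_cases hs : s ∈ T <;> simp [survOrLeave, hs]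
  | succ t ih =>
    by_cases hs : s ∈ T
    · simp [survOrLeave, hs]
    · simp only [survOrLeave, hs, if_false]
      refine PMF.tsum_mul_le _ fun x _ => ?_
      split_ifs
      · exact PMF.tsum_mul_le _ fun s' _ => ih _ _
      · exact le_rfl

lemma tendsto_survOrLeave (t : ℕ) (s : S) (m : σ.Mem) :
    Tendsto (fun L => σ.survOrLeave T L t s m) atTop (𝓝 (σ.surv T t s m)) := by
  induction t generalizing s m with
  | zero => exact tendsto_const_nhds
  | succ t ih =>
    by_cases hs : s ∈ T
    · simp [survOrLeave, surv, hs]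
    · simp only [survOrLeave, surv, hs, if_false]
      refine PMF.tendsto_tsum_mul _ (fun L x => ?_) fun x => ?_
      · split_ifs
        · exact PMF.tsum_mul_le _ fun s' _ => survOrLeave_le_one ..
        · exact le_rfl
      · refine (PMF.tendsto_tsum_mul (M.P s x.1) (fun L s' => survOrLeave_le_one _ _ L _ _ _)
          fun s' => ih s' x.2).congr' ?_
        filter_upwards [eventually_gt_atTop (σ.memIndex x.2)] with L hL
        rw [if_pos hL]

lemma surv_truncate_cut_le {t r : ℕ} (htr : t ≤ r) (hr : r ≤ N) (s : S) {m : σ.Mem}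
    (hm : σ.memIndex m < L) :
    (σ.truncate ρ N L).surv T t s (σ.cut N L m r) ≤ σ.survOrLeave T L t s m := by
  induction t generalizing s m r with
  | zero => exact le_rfl
  | succ t ih =>
    by_cases hs : s ∈ T
    · simp [surv_of_mem _ _ hs]
    obtain ⟨r, rfl⟩ : ∃ r', r = r' + 1 := ⟨r - 1, by omega⟩
    rw [cut, dif_pos ⟨hm, hr⟩, surv_truncate_some _ _ _ _ _ hs]
    simp only [survOrLeave, hs, if_false]
    refine PMF.tsum_mul_mono _ fun x _ => ?_
    split_ifs with hx
    · exact PMF.tsum_mul_mono _ fun s' _ => ih (by omega) (by omega) s' hx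
    · exact PMF.tsum_mul_le _ fun s' _ => surv_le_one ..

/-- Once all rounds of the truncated strategy are over, its survival probability decays like that of
the memoryless one, provided that `σ` visits `T` almost surely. -/
lemma surv_truncate_cut_decay {n : ℕ} {q : ℝ≥0∞}
    (hρ : ∀ s ∈ winning M T, ∀ t,
      (memoryless ρ).surv T (t + n) s () ≤ q * (memoryless ρ).surv T t s ())
    {t r : ℕ} (hrt : r ≤ t) {s : S} {m : σ.Mem} (h : σ.Vanishes T s m) :
    (σ.truncate ρ N L).surv T (t + n) s (σ.cut N L m r) ≤
      q * (σ.truncate ρ N L).surv T t s (σ.cut N L m r) := by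
  induction r generalizing t s m with
  | zero =>
    rw [cut, surv_truncate_none, surv_truncate_none]
    exact hρ s ⟨σ, m, h⟩ t
  | succ r ih =>
    by_cases hc : σ.memIndex m < L ∧ r < N
    · by_cases hs : s ∈ T
      · simp [surv_of_mem _ _ hs]
      obtain ⟨t, rfl⟩ : ∃ t', t = t' + 1 := ⟨t - 1, by omega⟩
      rw [cut, dif_pos hc, show t + 1 + n = t + n + 1 by omega,
        surv_truncate_some _ _ _ _ _ hs, surv_truncate_some _ _ _ _ _ hs, ← ENNReal.tsum_mul_left]
      refine (PMF.tsum_mul_mono _ fun x hx => ?_).trans_eq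
        (tsum_congr fun x => mul_left_comm (σ.act s m x) q _)
      rw [← ENNReal.tsum_mul_left]
      exact (PMF.tsum_mul_mono _ fun s' hs' => ih (by omega) (h.succ hs hx hs')).trans_eq
        (tsum_congr fun s' => mul_left_comm (M.P s x.1 s') q _)
    · rw [cut, dif_neg hc, surv_truncate_none, surv_truncate_none]
      exact hρ s ⟨σ, m, h⟩ t

end MDP.Strategy

/-! ### Near-optimal finite-memory profiles -/

/-- A geometric series over the residue classes modulo `n`. -/
lemma ENNReal.tsum_add_le_of_geometric_decay {b : ℕ → ℝ≥0∞} (hb : Antitone b) {N n : ℕ}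
    (hn : 0 < n) {q : ℝ≥0∞} (h : ∀ t, N ≤ t → b (t + n) ≤ q * b t) :
    ∑' t, b (t + N) ≤ n * (1 - q)⁻¹ * b N := by
  have : NeZero n := ⟨hn.ne'⟩
  have hpow : ∀ k t, N ≤ t → b (k * n + t) ≤ q ^ k * b t := by
    intro k
    induction k with
    | zero => intro t _; simp
    | succ k ih =>
      intro t ht
      calc b ((k + 1) * n + t) = b ((k * n + t) + n) := by congr 1; ring
        _ ≤ q * b (k * n + t) := h _ (by omega)
        _ ≤ q * (q ^ k * b t) := by gcongr; exact ih t ht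
        _ = _ := by ring
  rw [← (Nat.divModEquiv n).symm.tsum_eq]
  calc ∑' p : ℕ × Fin n, b ((Nat.divModEquiv n).symm p + N)
      ≤ ∑' p : ℕ × Fin n, q ^ p.1 * b N := by
        refine ENNReal.tsum_le_tsum fun p => ?_
        calc b (p.1 * n + p.2 + N) = b (p.1 * n + (p.2 + N)) := by rw [add_assoc]
          _ ≤ q ^ p.1 * b (p.2 + N) := hpow _ _ (by omega)
          _ ≤ _ := by gcongr; exact hb (by omega)
    _ = n * (1 - q)⁻¹ * b N := by
        rw [ENNReal.tsum_prod (f := fun (k : ℕ) (_ : Fin n) => q ^ k * b N)]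
        simp only [tsum_fintype, Finset.sum_const, Finset.card_univ, Fintype.card_fin,
          nsmul_eq_mul, ENNReal.tsum_mul_left, ENNReal.tsum_mul_right, ENNReal.tsum_geometric]
        ring

namespace MSSP.Profile

open MDP.Strategy

variable {S Act : Type*} {k : ℕ} {I : MSSP S Act k}

/-- If the expected hitting time is finite, then some agent visits its targets almost surely: by
independence the probability that no agent ever does is a product over the agents. -/
lemma exists_vanishes_of_EMHit_ne_top [Countable S] {π : I.Profile} (h : π.EMHit ≠ ∞) :
    ∃ i, (π i).Vanishes (I.target i) (I.init i) (π i).m₀ := by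
  rw [EMHit_eq_tsum] at h
  have h0 := ENNReal.tendsto_atTop_zero_of_tsum_ne_top h
  have h1 : ∀ i, Tendsto (π.agentSurv i) atTop (𝓝 (⨅ t, π.agentSurv i t)) := fun i =>
    tendsto_atTop_iInf (π.agentSurv_antitone i)
  have h2 : Tendsto (fun t => ∏ i, π.agentSurv i t) atTop (𝓝 (∏ i, ⨅ t, π.agentSurv i t)) :=
    ENNReal.tendsto_finsetProd_of_ne_top _ (fun i _ => h1 i) fun i _ =>
      ne_top_of_le_ne_top ENNReal.one_ne_top ((iInf_le _ 0).trans (π.agentSurv_le_one i 0))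
  obtain ⟨i, -, hi⟩ := Finset.prod_eq_zero_iff.1 (tendsto_nhds_unique h2 h0)
  have hi' := h1 i
  rw [hi] at hi'
  exact ⟨i, hi'⟩

/-- If the survival probability of one agent decays geometrically from time `N` on, then the cost
after time `N` is at most a constant times the probability of surviving up to `N`. -/
lemma EMHit_le_of_decay [Countable S] (π : I.Profile) (i : Fin k) {N n : ℕ} (hn : 0 < n)
    {q : ℝ≥0∞} (h : ∀ t, N ≤ t → π.agentSurv i (t + n) ≤ q * π.agentSurv i t) :
    π.EMHit ≤ ∑ t ∈ Finset.range N, ∏ j, π.agentSurv j t +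
      n * (1 - q)⁻¹ * ∏ j, π.agentSurv j N := by
  classical
  set b : ℕ → ℝ≥0∞ := fun t => ∏ j, π.agentSurv j t
  have hb : Antitone b := fun s t hst =>
    Finset.prod_le_prod' fun j _ => π.agentSurv_antitone j hst
  have hsum : π.EMHit = ∑ t ∈ Finset.range N, b t + ∑' t, b (t + N) := by
    rw [EMHit_eq_tsum]
    exact (ENNReal.summable.sum_add_tsum_nat_add' (f := b)).symm
  rw [hsum]
  refine add_le_add le_rfl (ENNReal.tsum_add_le_of_geometric_decay hb hn fun t ht => ?_)
  change ∏ j, π.agentSurv j (t + n) ≤ q * ∏ j, π.agentSurv j t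
  rw [← Finset.mul_prod_erase _ _ (Finset.mem_univ i),
    ← Finset.mul_prod_erase _ (π.agentSurv · t) (Finset.mem_univ i), ← mul_assoc]
  exact mul_le_mul' (h t ht) (Finset.prod_le_prod' fun j _ =>
    π.agentSurv_antitone j (Nat.le_add_right _ _))

lemma exists_finiteMemory_isEpsOptimal [Finite S] [Finite Act] (I : MSSP S Act k) {ε : ℝ}
    (hε : 0 < ε) : ∃ π : I.Profile, π.FiniteMemory ∧ π.IsEpsOptimal ε := by
  classical
  choose ρ n q hn hq hdecay using fun i => exists_memoryless_decay I.M (I.target i)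
  by_cases hinf : (⨅ π : I.Profile, π.EMHit) = ∞
  · refine ⟨fun i => memoryless (ρ i), fun i => inferInstanceAs (Finite Unit), ?_⟩
    simp [IsEpsOptimal, hinf]
  have hε' : ENNReal.ofReal ε / 2 ≠ 0 := by simpa using hε
  obtain ⟨π, hπ⟩ := iInf_lt_iff.1 (ENNReal.lt_add_right hinf hε')
  have hfin : π.EMHit ≠ ∞ := hπ.ne_top
  obtain ⟨i, hi⟩ := exists_vanishes_of_EMHit_ne_top hfin
  set b : ℕ → ℝ≥0∞ := fun t => ∏ j, π.agentSurv j t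
  have hE : π.EMHit = ∑' t, b t := π.EMHit_eq_tsum
  have hb0 : Tendsto b atTop (𝓝 0) := ENNReal.tendsto_atTop_zero_of_tsum_ne_top (hE ▸ hfin)
  set C : ℝ≥0∞ := n i * (1 - q i)⁻¹
  have hCtop : C ≠ ∞ :=
    ENNReal.mul_ne_top (ENNReal.natCast_ne_top _) (ENNReal.inv_ne_top.2 (tsub_pos_of_lt (hq i)).ne')
  -- the cost after time `N` is at most `C * b N`, up to the error of the truncation
  obtain ⟨N, hN⟩ : ∃ N, C * b N < ENNReal.ofReal ε / 2 := by
    have := ENNReal.Tendsto.const_mul (a := C) hb0 (Or.inr hCtop)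
    rw [mul_zero] at this
    exact (this.eventually_lt_const (pos_iff_ne_zero.2 hε')).exists
  let π' : ℕ → I.Profile := fun L j => (π j).truncate (ρ j) N L
  let b' : ℕ → ℕ → ℝ≥0∞ := fun L t => ∏ j, (π' L).agentSurv j t
  let w : ℕ → ℕ → ℝ≥0∞ := fun L t =>
    ∏ j, (π j).survOrLeave (I.target j) L t (I.init j) (π j).m₀
  have hb'w : ∀ᶠ L in atTop, ∀ t ≤ N, b' L t ≤ w L t := by
    have : ∀ᶠ L in atTop, ∀ j, (π j).memIndex (π j).m₀ < L :=
      eventually_all.2 fun j => eventually_gt_atTop _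
    filter_upwards [this] with L hL t ht
    exact Finset.prod_le_prod' fun j _ => surv_truncate_cut_le _ _ _ _ _ ht le_rfl _ (hL j)
  have hw : ∀ t, Tendsto (fun L => w L t) atTop (𝓝 (b t)) := fun t =>
    ENNReal.tendsto_finsetProd_of_ne_top _ (fun j _ => tendsto_survOrLeave ..) fun j _ =>
      ne_top_of_le_ne_top ENNReal.one_ne_top (π.agentSurv_le_one j t)
  have hcost : ∀ L, (π' L).EMHit ≤ ∑ t ∈ Finset.range N, b' L t + C * b' L N := fun L =>
    (π' L).EMHit_le_of_decay i (hn i) fun t ht =>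
      surv_truncate_cut_decay (π i) (I.target i) (ρ i) N L (hdecay i) ht hi
  have hlim : Tendsto (fun L => ∑ t ∈ Finset.range N, w L t + C * w L N) atTop
      (𝓝 (∑ t ∈ Finset.range N, b t + C * b N)) :=
    (tendsto_finsetSum _ fun t _ => hw t).add (ENNReal.Tendsto.const_mul (hw N) (Or.inr hCtop))
  have hlt : ∑ t ∈ Finset.range N, b t + C * b N <
      (⨅ π' : I.Profile, π'.EMHit) + ENNReal.ofReal ε := by
    calc ∑ t ∈ Finset.range N, b t + C * b N ≤ π.EMHit + C * b N := by
          gcongr; rw [hE]; exact ENNReal.sum_le_tsum _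
      _ < (⨅ π' : I.Profile, π'.EMHit) + ENNReal.ofReal ε / 2 + ENNReal.ofReal ε / 2 :=
          ENNReal.add_lt_add hπ hN
      _ = _ := by rw [add_assoc, ENNReal.add_halves]
  obtain ⟨L, hL, hL'⟩ := ((hlim.eventually_lt_const hlt).and hb'w).exists
  refine ⟨π' L, fun j => finite_mem_truncate .., (hcost L).trans (le_trans ?_ hL.le)⟩
  gcongr with t ht
  · exact hL' t (Finset.mem_range.1 ht).le
  · exact hL' N le_rfl

end MSSP.Profile

/-! ### Pumping for nonnegative recursions on a finite set -/

section Pumping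

variable {α : Type*} {A : α → α → ℝ≥0∞} {b : ℕ → α → ℝ≥0∞}

/-- The weight of the path `p 0, …, p t` with transition weights `A` and terminal weight `f`. -/
def pathWeight (A : α → α → ℝ≥0∞) (f : α → ℝ≥0∞) (p : ℕ → α) (t : ℕ) : ℝ≥0∞ :=
  (∏ l ∈ Finset.range t, A (p l) (p (l + 1))) * f (p t)

lemma pathWeight_succ (f : α → ℝ≥0∞) (p : ℕ → α) (t : ℕ) :
    pathWeight A f p (t + 1) = A (p 0) (p 1) * pathWeight A f (fun l => p (l + 1)) t := by
  simp only [pathWeight, Finset.prod_range_succ']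
  ring

variable [Fintype α]

lemma exists_le_card_pow_mul_pathWeight (hb : ∀ t a, b (t + 1) a = ∑ a', A a a' * b t a') (t : ℕ)
    (a : α) : ∃ p : ℕ → α, p 0 = a ∧ b t a ≤ Fintype.card α ^ t * pathWeight A (b 0) p t := by
  induction t generalizing a with
  | zero => exact ⟨fun _ => a, rfl, by simp [pathWeight]⟩
  | succ t ih =>
    have : Nonempty α := ⟨a⟩
    obtain ⟨a', ha'⟩ := Finite.exists_max fun a' => A a a' * b t a'
    obtain ⟨p, hp0, hp⟩ := ih a'
    refine ⟨fun l => l.casesOn a p, rfl, ?_⟩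
    calc b (t + 1) a ≤ ∑ _a' : α, A a a' * b t a' := by
          rw [hb]; exact Finset.sum_le_sum fun c _ => ha' c
      _ = Fintype.card α * (A a a' * b t a') := by simp
      _ ≤ Fintype.card α * (A a a' * (Fintype.card α ^ t * pathWeight A (b 0) p t)) := by gcongr
      _ = _ := by
          rw [pathWeight_succ]
          change _ = _ * (A a (p 0) * pathWeight A (b 0) p t)
          rw [hp0]
          ring

lemma pathWeight_le (hb : ∀ t a, b (t + 1) a = ∑ a', A a a' * b t a') (t : ℕ) (p : ℕ → α) :
    pathWeight A (b 0) p t ≤ b t (p 0) := by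
  induction t generalizing p with
  | zero => simp [pathWeight]
  | succ t ih =>
    have h := ih fun l => p (l + 1)
    calc pathWeight A (b 0) p (t + 1)
        = A (p 0) (p 1) * pathWeight A (b 0) (fun l => p (l + 1)) t :=
          pathWeight_succ ..
      _ ≤ A (p 0) (p 1) * b t (p 1) := by gcongr
      _ ≤ b (t + 1) (p 0) := by
          rw [hb]
          exact Finset.single_le_sum (f := fun a' => A (p 0) a' * b t a')
            (fun _ _ => zero_le) (Finset.mem_univ (p 1))

/-- Removing a cycle from a path with `n` steps, at least as many as there are points, does not
decrease its weight. -/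
lemma exists_pathWeight_le_of_card_le (hA : ∀ a a', A a a' ≤ 1) (f : α → ℝ≥0∞) {n : ℕ}
    (hn : Fintype.card α ≤ n) (p : ℕ → α) :
    ∃ (p' : ℕ → α) (t : ℕ), t < n ∧ p' 0 = p 0 ∧ pathWeight A f p n ≤ pathWeight A f p' t := by
  obtain ⟨i, j, hij, hjn, hp⟩ : ∃ i j, i < j ∧ j ≤ n ∧ p i = p j := by
    obtain ⟨x, y, hxy, h⟩ := Fintype.exists_ne_map_eq_of_card_lt (fun l : Fin (n + 1) => p l)
      (by simpa using Nat.lt_succ_of_le hn)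
    rcases lt_or_gt_of_ne hxy with hlt | hlt
    · exact ⟨x, y, hlt, Nat.le_of_lt_succ y.2, h⟩
    · exact ⟨y, x, hlt, Nat.le_of_lt_succ x.2, h.symm⟩
  let p' : ℕ → α := fun l => if l ≤ i then p l else p (l + (j - i))
  have hlow : ∀ l ≤ i, p' l = p l := fun l hl => if_pos hl
  have hhigh : ∀ l, p' (i + l) = p (j + l) := by
    intro l
    rcases Nat.eq_zero_or_pos l with rfl | hl
    · simp [p', hp]
    · simp only [p', if_neg (show ¬ i + l ≤ i by omega)]
      congr 1; omega
  refine ⟨p', i + (n - j), by omega, hlow 0 (Nat.zero_le _), ?_⟩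
  obtain ⟨c, rfl⟩ : ∃ c, j = i + c := ⟨j - i, by omega⟩
  obtain ⟨d, rfl⟩ : ∃ d, n = i + c + d := ⟨n - (i + c), by omega⟩
  rw [Nat.add_sub_cancel_left]
  simp only [pathWeight, Finset.prod_range_add]
  have h1 : ∏ l ∈ Finset.range i, A (p' l) (p' (l + 1)) =
      ∏ l ∈ Finset.range i, A (p l) (p (l + 1)) :=
    Finset.prod_congr rfl fun l hl => by
      have := Finset.mem_range.1 hl
      rw [hlow l (by omega), hlow (l + 1) (by omega)]
  have h2 : ∏ l ∈ Finset.range d, A (p' (i + l)) (p' (i + l + 1)) =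
      ∏ l ∈ Finset.range d, A (p (i + c + l)) (p (i + c + l + 1)) :=
    Finset.prod_congr rfl fun l _ => by rw [add_assoc i l 1, hhigh, hhigh]; rfl
  rw [h1, h2, hhigh]
  gcongr
  exact mul_le_of_le_one_right' (Finset.prod_le_one' fun l _ => hA _ _)

/-- A recursion `b (t + 1) = A (b t)` with entries of `A` in `[0, 1]` on at most `n` points cannot
produce a large value at time `n` without a value of comparable size before. -/
lemma le_pow_mul_sum_of_card_le (hA : ∀ a a', A a a' ≤ 1)
    (hb : ∀ t a, b (t + 1) a = ∑ a', A a a' * b t a') {n : ℕ} (hn : Fintype.card α ≤ n) (a : α) :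
    b n a ≤ n ^ n * ∑ t ∈ Finset.range n, b t a := by
  obtain ⟨p, hp0, hp⟩ := exists_le_card_pow_mul_pathWeight hb n a
  obtain ⟨p', t, ht, hp', hle⟩ := exists_pathWeight_le_of_card_le hA (b 0) hn p
  calc b n a ≤ Fintype.card α ^ n * pathWeight A (b 0) p n := hp
    _ ≤ n ^ n * pathWeight A (b 0) p' t := by gcongr
    _ ≤ n ^ n * b t a := by
        gcongr
        exact (pathWeight_le hb t p').trans_eq (by rw [hp', hp0])
    _ ≤ _ := by
        gcongr
        exact Finset.single_le_sum (f := fun t => b t a) (fun _ _ => zero_le)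
          (Finset.mem_range.2 ht)

end Pumping

/-! ### An instance that requires counting -/

/-- The states of the MDP in which one agent has to count to `n`: a line with `n + 3` states for the
first agent; the second agent starts in `wait`, has the target `goal`, and is lost in `dead`. -/
inductive GapState (n : ℕ)
  | line (i : Fin (n + 3))
  | wait
  | goal
  | dead

namespace GapState

variable {n : ℕ}

instance : Finite (GapState n) :=
  Finite.of_surjective (fun x : Fin (n + 3) ⊕ Fin 3 => match x with
    | .inl i => line i
    | .inr 0 => wait
    | .inr 1 => goal
    | .inr 2 => dead) fun s => match s with
    | line i => ⟨.inl i, rfl⟩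
    | wait => ⟨.inr 0, rfl⟩
    | goal => ⟨.inr 1, rfl⟩
    | dead => ⟨.inr 2, rfl⟩

/-- The action `true` in `wait` leads to `goal` with probability `1 / 2` and otherwise back to
`wait`; the action `false` leads to `goal` with probability `3 / 5` and otherwise to `dead`. In the
other states the actions make no difference: the line is walked to its end, and `goal` and `dead`
are absorbing. -/
def next : GapState n → Bool → PMF (GapState n)
  | line i, _ => PMF.pure (line ⟨min (i + 1) (n + 2), by omega⟩)
  | wait, true => (PMF.uniformOfFintype (Fin 2)).map fun i => if i.1 < 1 then goal else wait
  | wait, false => (PMF.uniformOfFintype (Fin 5)).map fun i => if i.1 < 3 then goal else dead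
  | goal, _ => PMF.pure goal
  | dead, _ => PMF.pure dead

end GapState

open GapState

/-- The MDP with the transitions `GapState.next`. -/
abbrev gapMDP (n : ℕ) : MDP (GapState n) Bool where
  En _ := Set.univ
  en_nonempty _ := Set.univ_nonempty
  P s a := s.next a.1

/-- The first agent walks along the line and arrives at its target, the end of the line, at time
`n + 2`; the second agent walks from `wait` to `goal`. -/
abbrev gapMSSP (n : ℕ) : MSSP (GapState n) Bool 2 where
  M := gapMDP n
  init := ![line 0, wait]
  target := ![{line (Fin.last (n + 2))}, {goal}]

namespace MDP.Strategy

variable {n : ℕ} (σ : (gapMDP n).Strategy)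

lemma surv_line (t : ℕ) (i : Fin (n + 3)) (m : σ.Mem) :
    σ.surv {line (Fin.last (n + 2))} t (line i) m = if i + t < n + 2 then 1 else 0 := by
  induction t generalizing i m with
  | zero =>
    by_cases hi : i = Fin.last (n + 2)
    · subst hi; simp [surv_of_mem]
    · have : i.1 < n + 2 := Fin.val_lt_last hi
      rw [surv_zero_of_notMem _ _ (by simpa using hi)]
      simp [this]
  | succ t ih =>
    by_cases hi : i = Fin.last (n + 2)
    · subst hi; simp [surv_of_mem]
    · have : i.1 < n + 2 := Fin.val_lt_last hi
      rw [surv_succ_of_notMem _ _ (by simpa using hi)]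
      have h : ∀ x : Set.univ × σ.Mem, ∑' s', (line i).next x.1.1 s' *
          σ.surv {line (Fin.last (n + 2))} t s' x.2 = if i + (t + 1) < n + 2 then 1 else 0 := by
        intro x
        simp only [GapState.next, PMF.pure_apply, ite_mul, one_mul, zero_mul, tsum_ite_eq, ih]
        have : min (i.1 + 1) (n + 2) + t < n + 2 ↔ i.1 + (t + 1) < n + 2 := by omega
        simp only [this]
      simp_rw [h, ENNReal.tsum_mul_right, PMF.tsum_coe, one_mul]

lemma surv_dead (t : ℕ) (m : σ.Mem) : σ.surv {goal} t dead m = 1 := by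
  induction t generalizing m with
  | zero => rw [surv_zero_of_notMem _ _ (by simp)]
  | succ t ih =>
    rw [surv_succ_of_notMem _ _ (by simp)]
    simp [GapState.next, ih, PMF.tsum_coe]

/-- The iterates of the operator that averages over the next memory state, on the event that the
second agent plays `true` in `wait` and returns to `wait`. -/
def waitIter (f : σ.Mem → ℝ≥0∞) : ℕ → σ.Mem → ℝ≥0∞
  | 0, m => f m
  | t + 1, m => ∑' m', σ.act wait m (⟨true, trivial⟩, m') * 2⁻¹ * waitIter f t m'

/-- The probability that the second agent, started in `wait` with memory `m`, is in `wait` at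
time `t`. -/
def waitProb : ℕ → σ.Mem → ℝ≥0∞ := σ.waitIter fun _ => 1

/-- The probability that the second agent, started in `wait` with memory `m`, is in `wait` at
time `t` and plays `false` there. -/
def gambleProb : ℕ → σ.Mem → ℝ≥0∞ :=
  σ.waitIter fun m => ∑' m', σ.act wait m (⟨false, trivial⟩, m')

lemma tsum_act_mul (s : GapState n) (m : σ.Mem) (g : Bool → σ.Mem → ℝ≥0∞) :
    ∑' x, σ.act s m x * g x.1.1 x.2 = ∑' m', σ.act s m (⟨true, trivial⟩, m') * g true m' +
      ∑' m', σ.act s m (⟨false, trivial⟩, m') * g false m' := by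
  rw [ENNReal.tsum_prod' (f := fun x => σ.act s m x * g x.1.1 x.2),
    ← (Equiv.Set.univ Bool).symm.tsum_eq, tsum_bool, add_comm]
  rfl

/-- In `wait` the agent plays `false`, or `true` and then returns with probability `1 / 2`. -/
lemma waitProb_eq_add (t : ℕ) (m : σ.Mem) :
    σ.waitProb t m = σ.gambleProb t m + 2 * σ.waitProb (t + 1) m := by
  induction t generalizing m with
  | zero =>
    have h := σ.tsum_act_mul wait m fun _ _ => 1
    simp only [mul_one, PMF.tsum_coe] at h
    simp only [waitProb, gambleProb, waitIter, mul_one, ENNReal.tsum_mul_right]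
    rw [h, add_comm, mul_comm 2, mul_assoc, ENNReal.inv_mul_cancel (by simp) (by simp), mul_one]
  | succ t ih =>
    calc σ.waitProb (t + 1) m
        = ∑' m', σ.act wait m (⟨true, trivial⟩, m') * 2⁻¹ * σ.waitProb t m' := rfl
      _ = ∑' m', (σ.act wait m (⟨true, trivial⟩, m') * 2⁻¹ * σ.gambleProb t m' +
            2 * (σ.act wait m (⟨true, trivial⟩, m') * 2⁻¹ * σ.waitProb (t + 1) m')) := by
          refine tsum_congr fun m' => ?_
          rw [ih]; ring
      _ = _ := by rw [ENNReal.tsum_add, ENNReal.tsum_mul_left]; rfl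

lemma waitProb_le_one (t : ℕ) (m : σ.Mem) : σ.waitProb t m ≤ 1 := by
  induction t with
  | zero => exact le_rfl
  | succ t ih =>
    refine le_trans ?_ ih
    rw [σ.waitProb_eq_add t m, two_mul]
    exact le_add_left (le_add_right le_rfl)

lemma gambleProb_le_waitProb (t : ℕ) (m : σ.Mem) : σ.gambleProb t m ≤ σ.waitProb t m := by
  rw [σ.waitProb_eq_add t m]
  exact le_self_add

/-- The second agent survives by staying in `wait` or by a lost gamble in the past. -/
lemma surv_wait (t : ℕ) (m : σ.Mem) :
    σ.surv {goal} t wait m =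
      σ.waitProb t m + 2 / 5 * ∑ i ∈ Finset.range t, σ.gambleProb i m := by
  induction t generalizing m with
  | zero => simp [surv, waitProb, waitIter]
  | succ t ih =>
    have htrue : ∀ m', ∑' s', (wait : GapState n).next true s' * σ.surv {goal} t s' m' =
        2⁻¹ * σ.surv {goal} t wait m' := by
      intro m'
      rw [GapState.next, PMF.tsum_map_mul, tsum_fintype]
      simp [Fin.sum_univ_two, surv_of_mem]
    have hfalse : ∀ m', ∑' s', (wait : GapState n).next false s' * σ.surv {goal} t s' m' =
        2 / 5 := by
      intro m'
      rw [GapState.next, PMF.tsum_map_mul, tsum_fintype]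
      simp [Fin.sum_univ_five, surv_of_mem, surv_dead]
      rw [← two_mul, ENNReal.div_eq_inv_mul, mul_comm]
    rw [surv_succ_of_notMem _ _ (by simp),
      σ.tsum_act_mul wait m fun a m' => ∑' s', wait.next a s' * σ.surv {goal} t s' m']
    simp_rw [htrue, hfalse, ih, ENNReal.tsum_mul_right]
    rw [Finset.sum_range_succ', mul_add, ← add_assoc]
    congr 1
    · simp_rw [mul_add, ENNReal.tsum_add]
      congr 1
      · exact tsum_congr fun m' => by rw [← mul_assoc]; rfl
      · simp_rw [gambleProb, waitIter, ← Summable.tsum_finsetSum (fun _ _ => ENNReal.summable),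
          ← ENNReal.tsum_mul_left]
        refine tsum_congr fun m' => ?_
        simp_rw [Finset.mul_sum]
        exact Finset.sum_congr rfl fun i _ => by ring
    · rw [mul_comm]; rfl

/-- With at most `n` memory states the second agent cannot wait for exactly `n` rounds. -/
lemma gambleProb_le_sum (hσ : ENat.card σ.Mem ≤ n) (m : σ.Mem) :
    σ.gambleProb n m ≤ n ^ n * ∑ t ∈ Finset.range n, σ.gambleProb t m := by
  have hfin : Finite σ.Mem := ENat.card_lt_top.1 (hσ.trans_lt (ENat.natCast_lt_top n))
  have := Fintype.ofFinite σ.Mem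
  refine le_pow_mul_sum_of_card_le
    (A := fun m m' => σ.act wait m (⟨true, trivial⟩, m') * 2⁻¹) (fun m m' => ?_) (fun t m => ?_)
    (by simpa using hσ) m
  · exact mul_le_one' (PMF.coe_le_one _ _) (by simp)
  · rw [← tsum_fintype (L := SummationFilter.unconditional _)]; rfl

/-- The strategy that counts the rounds up to `n` in its memory, plays `true` in the first `n` of
them, and `false` from then on. -/
abbrev countTo (n : ℕ) : (gapMDP n).Strategy where
  Mem := Fin (n + 1)
  mem_countable := inferInstance
  m₀ := 0
  act _ m := PMF.pure (⟨decide (m.1 < n), trivial⟩, ⟨min (m + 1) n, by omega⟩)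

lemma gambleProb_countTo (t : ℕ) (m : Fin (n + 1)) (h : m + t ≤ n) :
    (countTo n).gambleProb t m = if m + t = n then 2⁻¹ ^ t else 0 := by
  induction t generalizing m with
  | zero =>
    rw [gambleProb, waitIter]
    by_cases hm : m.1 < n
    · simp [hm, hm.ne, Subtype.ext_iff]
    · have hmn : m.1 = n := by omega
      rw [tsum_eq_single ⟨min (m + 1) n, by omega⟩]
      · simp [hmn]
      · intro m' hm'
        simp [hm']
  | succ t ih =>
    have hm : m.1 < n := by omega
    have hstep : (countTo n).gambleProb (t + 1) m =
        2⁻¹ * (countTo n).gambleProb t ⟨min (m + 1) n, by omega⟩ := by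
      rw [gambleProb, waitIter, tsum_eq_single ⟨min (m + 1) n, by omega⟩]
      · simp [hm]
      · intro m' hm'
        simp [hm']
    rw [hstep, ih _ (by simp; omega)]
    have : min (m.1 + 1) n + t = n ↔ m + (t + 1) = n := by omega
    simp only [this, mul_ite, mul_zero, pow_succ']

end MDP.Strategy

/-! ### The cost of a gambling time -/

section Cost

variable {x b : ℕ → ℝ}

/-- The solution of the recursion between the probabilities `x` of waiting and `b` of gambling. -/
lemma wait_eq (hx0 : x 0 = 1) (hx : ∀ t, x t = b t + 2 * x (t + 1)) (N : ℕ) :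
    x N = (1 / 2) ^ N - ∑ i ∈ Finset.range N, (1 / 2) ^ (N - i) * b i := by
  induction N with
  | zero => simp [hx0]
  | succ N ih =>
    have h : ∑ i ∈ Finset.range N, (1 / 2 : ℝ) ^ (N + 1 - i) * b i =
        1 / 2 * ∑ i ∈ Finset.range N, (1 / 2) ^ (N - i) * b i := by
      rw [Finset.mul_sum]
      refine Finset.sum_congr rfl fun i hi => ?_
      rw [Nat.succ_sub (Finset.mem_range.1 hi).le, pow_succ]; ring
    rw [Finset.sum_range_succ, h, Nat.add_sub_cancel_left, pow_succ]
    linarith [hx N]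

/-- The effect on the sum of the survival probabilities up to time `N` of a gamble at time `N - r`,
per unit of its probability and in comparison with not gambling at all: the loser of the gamble
survives at the `r` remaining times, and `∑ j ∈ [1, r], 2⁻¹ ^ j = 1 - 2⁻¹ ^ r` is saved. -/
def gambleCost (r : ℕ) : ℝ := 2 / 5 * r - 1 + (1 / 2) ^ r

/-- The sum of the survival probabilities of the second agent in terms of the gambling
probabilities alone. -/
lemma cost_eq (hx0 : x 0 = 1) (hx : ∀ t, x t = b t + 2 * x (t + 1)) (N : ℕ) :
    ∑ t ∈ Finset.range (N + 1), (x t + 2 / 5 * ∑ i ∈ Finset.range t, b i) =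
      ∑ t ∈ Finset.range (N + 1), (1 / 2) ^ t +
        ∑ i ∈ Finset.range N, gambleCost (N - i) * b i := by
  induction N with
  | zero => simp [hx0]
  | succ N ih =>
    have h0 : ∑ i ∈ Finset.range N, gambleCost (N - i) * b i =
        ∑ i ∈ Finset.range (N + 1), gambleCost (N - i) * b i := by
      simp [Finset.sum_range_succ, gambleCost]
    rw [Finset.sum_range_succ, ih, wait_eq hx0 hx (N + 1), h0,
      Finset.sum_range_succ (fun t => (1 / 2 : ℝ) ^ t) (N + 1), Finset.mul_sum]
    have h1 : ∑ i ∈ Finset.range (N + 1), gambleCost (N + 1 - i) * b i =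
        ∑ i ∈ Finset.range (N + 1), gambleCost (N - i) * b i +
          ∑ i ∈ Finset.range (N + 1), 2 / 5 * b i -
          ∑ i ∈ Finset.range (N + 1), (1 / 2) ^ (N + 1 - i) * b i := by
      rw [← Finset.sum_add_distrib, ← Finset.sum_sub_distrib]
      refine Finset.sum_congr rfl fun i hi => ?_
      rw [Nat.succ_sub (Nat.le_of_lt_succ (Finset.mem_range.1 hi))]
      simp only [gambleCost, pow_succ, Nat.cast_succ]
      ring
    rw [h1]
    ring

lemma one_div_twenty_le_gambleCost {r : ℕ} (hr : 2 ≤ r) : 1 / 20 ≤ gambleCost r := by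
  rcases hr.eq_or_lt with rfl | hr
  · norm_num [gambleCost]
  · have h1 : (3 : ℝ) ≤ r := by exact_mod_cast hr
    have h2 : (0 : ℝ) < (1 / 2) ^ r := by positivity
    rw [gambleCost]
    linarith

end Cost

namespace MSSP.Profile

variable {n : ℕ}

lemma toReal_EMHit_gapMSSP (π : (gapMSSP n).Profile) :
    π.EMHit ≠ ∞ ∧ π.EMHit.toReal = ∑ t ∈ Finset.range (n + 1 + 1),
      (((π 1).waitProb t (π 1).m₀).toReal +
        2 / 5 * ∑ i ∈ Finset.range t, ((π 1).gambleProb i (π 1).m₀).toReal) := by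
  have hx : ∀ t, (π 1).waitProb t (π 1).m₀ ≠ ∞ := fun t =>
    ne_top_of_le_ne_top ENNReal.one_ne_top ((π 1).waitProb_le_one t _)
  have hb : ∀ t, (π 1).gambleProb t (π 1).m₀ ≠ ∞ := fun t =>
    ne_top_of_le_ne_top (hx t) ((π 1).gambleProb_le_waitProb t _)
  have hE : π.EMHit = ∑ t ∈ Finset.range (n + 1 + 1), ((π 1).waitProb t (π 1).m₀ +
      2 / 5 * ∑ i ∈ Finset.range t, (π 1).gambleProb i (π 1).m₀) := by
    have h0 : ∀ t, π.agentSurv 0 t = if t < n + 2 then 1 else 0 := by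
      intro t
      have := (π 0).surv_line t 0 (π 0).m₀
      rw [Fin.val_zero, zero_add] at this
      exact this
    have h1 : ∀ t, π.agentSurv 1 t = (π 1).waitProb t (π 1).m₀ +
      2 / 5 * ∑ i ∈ Finset.range t, (π 1).gambleProb i (π 1).m₀ := fun t => (π 1).surv_wait t _
    simp_rw [EMHit_eq_tsum, Fin.prod_univ_two, h0, h1]
    rw [tsum_eq_sum (s := Finset.range (n + 1 + 1))]
    · refine Finset.sum_congr rfl fun t ht => ?_
      rw [if_pos (Finset.mem_range.1 ht), one_mul]
    · intro t ht
      rw [if_neg (fun h => ht (Finset.mem_range.2 h)), zero_mul]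
  have hs : ∀ t, ∑ i ∈ Finset.range t, (π 1).gambleProb i (π 1).m₀ ≠ ∞ := fun t =>
    ENNReal.sum_ne_top.2 fun i _ => hb i
  have h25 : (2 / 5 : ℝ≥0∞) ≠ ∞ := ENNReal.div_ne_top (by simp) (by simp)
  have hterm : ∀ t, (π 1).waitProb t (π 1).m₀ +
      2 / 5 * ∑ i ∈ Finset.range t, (π 1).gambleProb i (π 1).m₀ ≠ ∞ := fun t =>
    ENNReal.add_ne_top.2 ⟨hx t, ENNReal.mul_ne_top h25 (hs t)⟩
  rw [hE]
  refine ⟨ENNReal.sum_ne_top.2 fun t _ => hterm t, ?_⟩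
  rw [ENNReal.toReal_sum fun t _ => hterm t]
  refine Finset.sum_congr rfl fun t _ => ?_
  rw [ENNReal.toReal_add (hx t) (ENNReal.mul_ne_top h25 (hs t)), ENNReal.toReal_mul,
    ENNReal.toReal_sum fun i _ => hb i]
  simp

/-- The cost is a constant plus a weighted sum of the gambling probabilities, in which only the
weight of time `n` is negative. -/
lemma toReal_EMHit_gapMSSP_eq (π : (gapMSSP n).Profile) :
    π.EMHit.toReal = ∑ t ∈ Finset.range (n + 2), (1 / 2) ^ t +
      ∑ i ∈ Finset.range n, gambleCost (n + 1 - i) * ((π 1).gambleProb i (π 1).m₀).toReal -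
      1 / 10 * ((π 1).gambleProb n (π 1).m₀).toReal := by
  have hx : ∀ t, (π 1).waitProb t (π 1).m₀ ≠ ∞ := fun t =>
    ne_top_of_le_ne_top ENNReal.one_ne_top ((π 1).waitProb_le_one t _)
  have hb : ∀ t, (π 1).gambleProb t (π 1).m₀ ≠ ∞ := fun t =>
    ne_top_of_le_ne_top (hx t) ((π 1).gambleProb_le_waitProb t _)
  rw [(toReal_EMHit_gapMSSP π).2, cost_eq (x := fun t => ((π 1).waitProb t (π 1).m₀).toReal)
    (b := fun t => ((π 1).gambleProb t (π 1).m₀).toReal), Finset.sum_range_succ _ n,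
    Nat.add_sub_cancel_left]
  · norm_num [gambleCost]; ring
  · simp [MDP.Strategy.waitProb, MDP.Strategy.waitIter]
  · intro t
    rw [(π 1).waitProb_eq_add t, ENNReal.toReal_add (hb t) (ENNReal.mul_ne_top (by simp) (hx _)),
      ENNReal.toReal_mul]
    simp

/-- The cost of a profile with at most `n` memory states exceeds that of waiting for exactly `n`
rounds by a constant. -/
lemma le_toReal_EMHit_of_memAtMost (hn : 1 ≤ n) (π : (gapMSSP n).Profile) (hπ : π.MemAtMost n) :
    ∑ t ∈ Finset.range (n + 2), (1 / 2) ^ t - 1 / 10 * (1 / 2) ^ n + (1 / 2) ^ n / (20 * n ^ n) ≤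
      π.EMHit.toReal := by
  set b : ℕ → ℝ := fun t => ((π 1).gambleProb t (π 1).m₀).toReal
  have hx : ∀ t, (π 1).waitProb t (π 1).m₀ ≠ ∞ := fun t =>
    ne_top_of_le_ne_top ENNReal.one_ne_top ((π 1).waitProb_le_one t _)
  have hb : ∀ t, (π 1).gambleProb t (π 1).m₀ ≠ ∞ := fun t =>
    ne_top_of_le_ne_top (hx t) ((π 1).gambleProb_le_waitProb t _)
  have hb0 : ∀ t, 0 ≤ b t := fun t => ENNReal.toReal_nonneg
  have hbn : b n ≤ (1 / 2) ^ n := by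
    have h1 : b n ≤ ((π 1).waitProb n (π 1).m₀).toReal :=
      ENNReal.toReal_mono (hx n) ((π 1).gambleProb_le_waitProb n _)
    have h2 : ∀ t, ((π 1).waitProb t (π 1).m₀).toReal ≤ (1 / 2) ^ t := by
      intro t
      induction t with
      | zero => simp [MDP.Strategy.waitProb, MDP.Strategy.waitIter]
      | succ t ih =>
        have h := ENNReal.toReal_mono (hx t)
          (le_add_self.trans_eq ((π 1).waitProb_eq_add t (π 1).m₀).symm)
        rw [ENNReal.toReal_mul, ENNReal.toReal_ofNat] at h
        rw [pow_succ]
        linarith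
    exact h1.trans (h2 n)
  have hpump : b n ≤ n ^ n * ∑ t ∈ Finset.range n, b t := by
    have h := ENNReal.toReal_mono (ENNReal.mul_ne_top (by simp)
      (ENNReal.sum_ne_top.2 fun t _ => hb t)) ((π 1).gambleProb_le_sum (hπ 1) (π 1).m₀)
    rw [ENNReal.toReal_mul, ENNReal.toReal_sum fun t _ => hb t] at h
    simpa using h
  have hcost : 1 / 20 * ∑ t ∈ Finset.range n, b t ≤
      ∑ i ∈ Finset.range n, gambleCost (n + 1 - i) * b i := by
    rw [Finset.mul_sum]
    refine Finset.sum_le_sum fun i hi => mul_le_mul_of_nonneg_right ?_ (hb0 i)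
    have := Finset.mem_range.1 hi
    exact one_div_twenty_le_gambleCost (by omega)
  have hK : (1 : ℝ) ≤ n ^ n := one_le_pow₀ (by exact_mod_cast hn)
  -- if `b n` falls short of `2⁻¹ ^ n`, the first term pays for it; otherwise `hpump` makes the
  -- second one large
  have h3 : (1 / 2 : ℝ) ^ n / (20 * n ^ n) ≤
      1 / 10 * ((1 / 2) ^ n - b n) + 1 / 20 * ∑ t ∈ Finset.range n, b t := by
    rw [div_le_iff₀ (by positivity)]
    nlinarith [mul_nonneg (sub_nonneg.2 hbn) (sub_nonneg.2 hK)]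
  rw [toReal_EMHit_gapMSSP_eq π]
  linarith

end MSSP.Profile

/-- In `gapMSSP n`, counting to `n` is better than every use of `n` memory states. -/
lemma exists_memAtMost_succ_EMHit_lt (n : ℕ) (hn : 1 ≤ n) :
    ∃ π : (gapMSSP n).Profile, π.MemAtMost (n + 1) ∧
      π.EMHit < ⨅ (π' : (gapMSSP n).Profile) (_ : π'.MemAtMost n), π'.EMHit := by
  refine ⟨fun _ => MDP.Strategy.countTo n, fun _ => by simp, ?_⟩
  set π : (gapMSSP n).Profile := fun _ => MDP.Strategy.countTo n with hπ
  have hval : π.EMHit.toReal =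
      ∑ t ∈ Finset.range (n + 2), (1 / 2) ^ t - 1 / 10 * (1 / 2) ^ n := by
    rw [π.toReal_EMHit_gapMSSP_eq, Finset.sum_eq_zero (s := Finset.range n), add_zero]
    · have h : (π 1).gambleProb n (π 1).m₀ = 2⁻¹ ^ n :=
        (MDP.Strategy.gambleProb_countTo (n := n) n 0 (by simp)).trans (if_pos (by simp))
      simp [h]
    · intro i hi
      have hi := Finset.mem_range.1 hi
      have h : (π 1).gambleProb i (π 1).m₀ = 0 :=
        (MDP.Strategy.gambleProb_countTo (n := n) i 0 (by simpa using hi.le)).trans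
          (if_neg (by simpa using hi.ne))
      simp [h]
  have hgap : (0 : ℝ) < (1 / 2) ^ n / (20 * n ^ n) := by
    have : (0 : ℝ) < n := by exact_mod_cast hn
    positivity
  calc π.EMHit < ENNReal.ofReal (π.EMHit.toReal + (1 / 2) ^ n / (20 * n ^ n)) := by
        rw [ENNReal.lt_ofReal_iff_toReal_lt π.toReal_EMHit_gapMSSP.1]
        linarith
    _ ≤ _ := le_iInf₂ fun π' hπ' => by
        rw [ENNReal.ofReal_le_iff_le_toReal π'.toReal_EMHit_gapMSSP.1, hval]
        exact π'.le_toReal_EMHit_of_memAtMost hn hπ'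

end

theorem mainTheorem5 :
    (∀ n : ℕ, 1 ≤ n →
      ∃ (S Act : Type) (_ : Finite S) (_ : Finite Act) (I : MSSP S Act 2),
        (∀ i, I.init i ∉ I.target i ∧ (I.target i).Nonempty) ∧
        ∃ π : I.Profile, π.MemAtMost (n + 1) ∧
          π.EMHit < ⨅ (π' : I.Profile) (_ : π'.MemAtMost n), π'.EMHit) ∧
    (∀ (S Act : Type*) [Finite S] [Finite Act] (k : ℕ) (I : MSSP S Act k) (ε : ℝ), 1 ≤ k → 0 < ε →
      ∃ π : I.Profile, π.FiniteMemory ∧ π.IsEpsOptimal ε) := by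
  refine ⟨fun n hn => ⟨GapState n, Bool, inferInstance, inferInstance, gapMSSP n, ?_,
    exists_memAtMost_succ_EMHit_lt n hn⟩, fun S Act _ _ k I ε _ hε =>
    MSSP.Profile.exists_finiteMemory_isEpsOptimal I hε⟩
  intro i
  fin_cases i <;> simp [Fin.ext_iff]
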